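/- For $a,b,c\in\mathbb{Q}$ with $c\notin\{0,-1,-2,\dots\}$ let $${}_2F_1(a,b;c;z)=\sum_{m\ge 0}\frac{(a)_m(b)_m}{(c)_m\,m!}\,z^m\in\mathbb{Q}[[z]],\qquad (t)_m=t(t+1)\cdots(t+m-1).$$ Let $(a,b,c,\phi,\lambda)$ be one of the following $11$ tuples, where the rational function $\phi$ is identified with its Taylor expansion at $x=0$, a power series without constant term: \begin{enumerate} \item $\left(\tfrac12,\tfrac12,2,\ \tfrac{4x}{(1-x)^2},\ 4\right)$; \item $\left(\tfrac16,\tfrac23,\tfrac32,\ \tfrac{27x}{(1-4x)^3},\ 1\right)$; \item $\left(\tfrac13,\tfrac13,1,\ \tfrac{27x}{(1-4x)^3},\ 1\right)$; \item $\left(\tfrac16,\tfrac12,\tfrac12,\ \tfrac{27x}{(1-4x)^3},\ 1\right)$; \item $\left(\tfrac14,\tfrac34,\tfrac12,\ \tfrac{4x}{(1-x)^2},\ 1\right)$; \item $\left(\tfrac13,\tfrac23,\tfrac32,\ \tfrac{27x}{(1-4x)^3},\ 1\right)$; \item $\left(\tfrac14,\tfrac34,\tfrac32,\ \tfrac{27x}{(1-4x)^3},\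 4\right)$; \item $\left(\tfrac13,\tfrac23,1,\ \tfrac{27x}{(1-4x)^3},\ 1\right)$; \item $\left(\tfrac13,\tfrac12,\tfrac12,\ \tfrac{27x}{(1-4x)^3},\ 1\right)$; \item $\left(\tfrac23,\tfrac23,1,\ \tfrac{27x}{(1-4x)^3},\ 1\right)$; \item $\left(\tfrac12,\tfrac12,1,\ 4x(1-x),\ 4\right)$. \end{enumerate} Put $G(x)={}_2F_1(a,b;c;\phi(x))^2$ and $A(x)=G(\lambda x)={}_2F_1(a,b;c;\phi(\lambda x))^2=\sum_{n\ge 0}a_nx^n$, as formal power series. Then $A(x)\in\mathbb{Z}[[x]]$; equivalently, $a_n=\lambda^n[x^n]\,{}_2F_1(a,b;c;\phi(x))^2\in\mathbb{Z}$ for all $n\ge 0$. -/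

import Mathlib

open PowerSeries

/-- The Gauss hypergeometric series `₂F₁(a, b; c; z) = ∑ (a)ₘ (b)ₘ / ((c)ₘ m!) zᵐ` as a formal
power series over `ℚ`. -/
noncomputable def gaussSeries (a b c : ℚ) : ℚ⟦X⟧ :=
  PowerSeries.mk fun m => ordinaryHypergeometricCoefficient a b c m

/-- The formal power series `₂F₁(a, b; c; φ(x))²`, for a series `φ` without constant term. -/
noncomputable def gaussPullbackSquare (a b c : ℚ) (φ : ℚ⟦X⟧) : ℚ⟦X⟧ :=
  (PowerSeries.subst φ (gaussSeries a b c)) ^ 2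

/-- A tuple `(a, b, c, φ, λ)`; the rational function `φ` is given by its expansion at `0`. -/
structure ScanRow where
  a : ℚ
  b : ℚ
  c : ℚ
  φ : ℚ⟦X⟧
  lam : ℚ

/-- The expansion at `0` of `4x / (1 - x)²`. -/
noncomputable def belyiTwo : ℚ⟦X⟧ := 4 * X * ((1 - X) ^ 2)⁻¹

/-- The expansion at `0` of `27x / (1 - 4x)³`. -/
noncomputable def belyiThree : ℚ⟦X⟧ := 27 * X * ((1 - 4 * X) ^ 3)⁻¹

/-- The polynomial `4x(1 - x)`. -/
noncomputable def belyiPoly : ℚ⟦X⟧ := 4 * X * (1 - X)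

/-- The eleven rows, with scan labels #2, #3, #4, #5, #9, #10, #11, #12, #13, #14, #15. -/
noncomputable def scanRows : List ScanRow :=
  [ ⟨1 / 2, 1 / 2, 2,     belyiTwo,   4⟩,
    ⟨1 / 6, 2 / 3, 3 / 2, belyiThree, 1⟩,
    ⟨1 / 3, 1 / 3, 1,     belyiThree, 1⟩,
    ⟨1 / 6, 1 / 2, 1 / 2, belyiThree, 1⟩,
    ⟨1 / 4, 3 / 4, 1 / 2, belyiTwo,   1⟩,
    ⟨1 / 3, 2 / 3, 3 / 2, belyiThree, 1⟩,
    ⟨1 / 4, 3 / 4, 3 / 2, belyiThree, 4⟩,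
    ⟨1 / 3, 2 / 3, 1,     belyiThree, 1⟩,
    ⟨1 / 3, 1 / 2, 1 / 2, belyiThree, 1⟩,
    ⟨2 / 3, 2 / 3, 1,     belyiThree, 1⟩,
    ⟨1 / 2, 1 / 2, 1,     belyiPoly,  4⟩ ]

/-- Every `φ` in the list has zero constant term, so the substitution is the genuine one. -/
theorem ScanRow.hasSubst_of_mem {r : ScanRow} (hr : r ∈ scanRows) :
    PowerSeries.HasSubst r.φ := by
  apply PowerSeries.HasSubst.of_constantCoeff_zero'
  simp only [scanRows, List.mem_cons, List.not_mem_nil, or_false] at hr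
  rcases hr with h | h | h | h | h | h | h | h | h | h | h <;> subst h <;>
    simp [belyiTwo, belyiThree, belyiPoly]

/-- The denominators are inverted genuinely: `φ · (1 - x)² = 4x`. -/
theorem belyiTwo_mul : belyiTwo * (1 - X) ^ 2 = 4 * X := by
  rw [belyiTwo, mul_assoc, PowerSeries.inv_mul_cancel _ (by simp), mul_one]

/-- The denominators are inverted genuinely: `φ · (1 - 4x)³ = 27x`. -/
theorem belyiThree_mul : belyiThree * (1 - 4 * X) ^ 3 = 27 * X := by
  rw [belyiThree, mul_assoc, PowerSeries.inv_mul_cancel _ (by simp), mul_one]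

/-! Write `F` for the Gauss series. In every row `φ(λx) = κ w(x)` with `w ∈ xℤ[[x]]` and `κ ∈ {4,
16, 27}`, so it suffices that `F(κz)²` is integral: composing with `w` keeps coefficients in `ℤ`
(`exists_integral_of_rescale_sq_mem`). In most rows `F(κz)` itself is integral. Its coefficients are
products of central binomial and Catalan numbers, or are controlled by the 3-adic bound
`three_pow_mul_multichoose_mem`. When `c = 3/2` with denominators 3 and 6, two coprime multiples of
a coefficient are shown to be integers. Elsewhere the square matters. If `b = c`, then `F² = (1 -
z)^(-2a)`. For `(1/4, 3/4)`, `F(z²)` is, up to elementary factors, the even or odd part of `(1 -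
z)^(∓1/2)`, which gives closed forms for `F²`. -/

/-- The subring of power series over `ℚ` with integer coefficients. -/
noncomputable def integralSeries : Subring ℚ⟦X⟧ := (PowerSeries.map (Int.castRingHom ℚ)).range

/-- The subring of integers in `ℚ`. -/
def ratIntegers : Subring ℚ := (Int.castRingHom ℚ).range

theorem intCast_mem_ratIntegers (n : ℤ) : (n : ℚ) ∈ ratIntegers := ⟨n, rfl⟩

theorem natCast_mem_ratIntegers (n : ℕ) : (n : ℚ) ∈ ratIntegers := ⟨n, by simp⟩

theorem mem_integralSeries_iff {f : ℚ⟦X⟧} :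
    f ∈ integralSeries ↔ ∀ n, coeff n f ∈ ratIntegers := by
  constructor
  · rintro ⟨B, rfl⟩ n
    exact ⟨coeff n B, by simp⟩
  · intro h
    choose g hg using h
    exact ⟨mk g, by ext n; simpa using hg n⟩

/-! ### Reduction to a rescaled Gauss series. -/

theorem constantCoeff_map_intCast (f : ℤ⟦X⟧) :
    constantCoeff (PowerSeries.map (Int.castRingHom ℚ) f) = ((constantCoeff f : ℤ) : ℚ) := by
  rw [← coeff_zero_eq_constantCoeff_apply, coeff_map, coeff_zero_eq_constantCoeff_apply,
    eq_intCast]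

theorem subst_C_mul_eq (κ : ℚ) {ψ : ℚ⟦X⟧} (hψ : constantCoeff ψ = 0) (f : ℚ⟦X⟧) :
    subst (C κ * ψ) f = subst ψ (rescale κ f) := by
  have h := HasSubst.of_constantCoeff_zero' hψ
  rw [rescale_eq_subst, subst_comp_subst_apply (HasSubst.smul_X' κ) h]
  congr 1
  rw [subst_smul h, subst_X h, smul_eq_C_mul]

theorem rescale_subst (κ : ℚ) {ψ : ℚ⟦X⟧} (hψ : HasSubst ψ) (f : ℚ⟦X⟧) :
    rescale κ (subst ψ f) = subst (rescale κ ψ) f := by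
  rw [rescale_eq_subst, rescale_eq_subst, subst_comp_subst_apply hψ (HasSubst.smul_X' κ)]

theorem exists_integral_of_rescale_sq_mem {r : ScanRow} (hr : r ∈ scanRows) (κ : ℚ) (w : ℤ⟦X⟧)
    (hw : constantCoeff w = 0)
    (hφ : rescale r.lam r.φ = C κ * PowerSeries.map (Int.castRingHom ℚ) w)
    (hF : rescale κ (gaussSeries r.a r.b r.c ^ 2) ∈ integralSeries) :
    ∃ A : PowerSeries ℤ,
      PowerSeries.map (Int.castRingHom ℚ) A =
        PowerSeries.rescale r.lam (gaussPullbackSquare r.a r.b r.c r.φ) ∧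
      PowerSeries.map (Int.castRingHom ℚ) A =
        gaussPullbackSquare r.a r.b r.c (PowerSeries.rescale r.lam r.φ) ∧
      ∀ n : ℕ, ((PowerSeries.coeff n A : ℤ) : ℚ) =
        r.lam ^ n * PowerSeries.coeff n (gaussPullbackSquare r.a r.b r.c r.φ) := by
  obtain ⟨B, hB⟩ := hF
  have hs := ScanRow.hasSubst_of_mem hr
  have hw' : constantCoeff (PowerSeries.map (Int.castRingHom ℚ) w) = 0 := by
    rw [constantCoeff_map_intCast, hw, Int.cast_zero]
  have h2 : rescale r.lam (gaussPullbackSquare r.a r.b r.c r.φ) =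
      gaussPullbackSquare r.a r.b r.c (rescale r.lam r.φ) := by
    rw [gaussPullbackSquare, gaussPullbackSquare, map_pow, rescale_subst _ hs]
  have h1 : PowerSeries.map (Int.castRingHom ℚ) (subst w B) =
      gaussPullbackSquare r.a r.b r.c (rescale r.lam r.φ) := by
    rw [gaussPullbackSquare, hφ, subst_C_mul_eq _ hw',
      ← subst_pow (HasSubst.of_constantCoeff_zero' hw'), ← map_pow, ← hB]
    exact map_subst (HasSubst.of_constantCoeff_zero' hw) B
  refine ⟨subst w B, by rw [h1, h2], h1, fun n => ?_⟩
  rw [← coeff_rescale, h2, ← h1]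
  simp

/-! ### Writing the pullbacks as a scalar times an integral series. -/

theorem rescale_inv (κ : ℚ) (f : ℚ⟦X⟧) (hf : constantCoeff f ≠ 0) :
    rescale κ f⁻¹ = (rescale κ f)⁻¹ := by
  have hc : constantCoeff (rescale κ f) ≠ 0 := by
    rwa [← coeff_zero_eq_constantCoeff_apply, coeff_rescale, pow_zero, one_mul,
      coeff_zero_eq_constantCoeff_apply]
  rw [eq_comm, PowerSeries.inv_eq_iff_mul_eq_one hc, ← map_mul, PowerSeries.inv_mul_cancel _ hf,
    map_one]

theorem map_invOfUnit_one (f : ℤ⟦X⟧) (hf : constantCoeff f = 1) :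
    PowerSeries.map (Int.castRingHom ℚ) (invOfUnit f 1) =
      (PowerSeries.map (Int.castRingHom ℚ) f)⁻¹ := by
  have hc : constantCoeff (PowerSeries.map (Int.castRingHom ℚ) f) ≠ 0 := by
    simp [constantCoeff_map_intCast, hf]
  rw [eq_comm, PowerSeries.inv_eq_iff_mul_eq_one hc, ← map_mul, mul_comm,
    mul_invOfUnit _ _ (by simpa using hf), map_one]

theorem rescale_belyiTwo (κ : ℤ) :
    rescale (κ : ℚ) belyiTwo = C (4 * κ : ℚ) * PowerSeries.map (Int.castRingHom ℚ)
      (X * invOfUnit ((1 - C κ * X) ^ 2) 1) := by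
  rw [belyiTwo, map_mul, map_mul, rescale_inv _ _ (by simp), map_mul (PowerSeries.map _),
    map_invOfUnit_one _ (by simp)]
  simp only [map_mul, map_pow, map_sub, map_one, map_ofNat, rescale_X, map_X, map_intCast,
    eq_intCast]
  ring

theorem rescale_belyiThree (κ : ℤ) :
    rescale (κ : ℚ) belyiThree = C (27 * κ : ℚ) * PowerSeries.map (Int.castRingHom ℚ)
      (X * invOfUnit ((1 - C (4 * κ) * X) ^ 3) 1) := by
  rw [belyiThree, map_mul, map_mul, rescale_inv _ _ (by simp), map_mul (PowerSeries.map _),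
    map_invOfUnit_one _ (by simp)]
  simp only [map_mul, map_pow, map_sub, map_one, map_ofNat, rescale_X, map_X, map_intCast,
    eq_intCast]
  ring_nf

theorem rescale_belyiPoly (κ : ℤ) :
    rescale (κ : ℚ) belyiPoly = C (4 * κ : ℚ) * PowerSeries.map (Int.castRingHom ℚ)
      (X * (1 - C κ * X)) := by
  rw [belyiPoly]
  simp only [map_mul, map_sub, map_one, map_ofNat, rescale_X, map_X, map_intCast,
    eq_intCast]
  ring

/-! ### Binomial series and their products under `X ↦ -X`. -/

/-- The binomial series `(1 - X) ^ (-r)`. -/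
noncomputable def oneSubNegPow (r : ℚ) : ℚ⟦X⟧ := mk fun n => Ring.multichoose r n

theorem ascPochhammer_eval_eq (r : ℚ) (n : ℕ) :
    (ascPochhammer ℚ n).eval r = n.factorial * Ring.multichoose r n := by
  rw [← Polynomial.ascPochhammer_smeval_eq_eval, ← Ring.factorial_nsmul_multichoose_eq_ascPochhammer,
    nsmul_eq_mul]

theorem multichoose_eq_div (r : ℚ) (n : ℕ) :
    Ring.multichoose r n = (ascPochhammer ℚ n).eval r / n.factorial := by
  rw [ascPochhammer_eval_eq, mul_div_cancel_left₀ _ (by positivity)]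

theorem oneSubNegPow_eq_rescale (r : ℚ) :
    oneSubNegPow r = rescale (-1) (binomialSeries ℚ (-r)) := by
  ext n
  rw [oneSubNegPow, coeff_mk, coeff_rescale, binomialSeries_coeff, Ring.choose_neg',
    ← Int.cast_negOnePow_natCast]
  rcases Int.units_eq_one_or (n : ℤ).negOnePow with h | h <;> simp [h]

theorem oneSubNegPow_add (r s : ℚ) :
    oneSubNegPow (r + s) = oneSubNegPow r * oneSubNegPow s := by
  rw [oneSubNegPow_eq_rescale, neg_add, binomialSeries_add, map_mul, ← oneSubNegPow_eq_rescale,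
    ← oneSubNegPow_eq_rescale]

theorem oneSubNegPow_zero : oneSubNegPow 0 = 1 := by
  simp [oneSubNegPow_eq_rescale]

theorem oneSubNegPow_neg_one : oneSubNegPow (-1) = 1 - X := by
  have := binomialSeries_nat (R := ℚ) (A := ℚ) 1
  rw [oneSubNegPow_eq_rescale, neg_neg]
  rw [Nat.cast_one] at this
  simp [this, sub_eq_add_neg]

theorem constantCoeff_oneSubNegPow (r : ℚ) : constantCoeff (oneSubNegPow r) = 1 := by
  rw [← coeff_zero_eq_constantCoeff_apply, oneSubNegPow, coeff_mk, Ring.multichoose_zero_right]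

theorem constantCoeff_rescale_eq (κ : ℚ) (f : ℚ⟦X⟧) :
    constantCoeff (rescale κ f) = constantCoeff f := by
  rw [← coeff_zero_eq_constantCoeff_apply, coeff_rescale, pow_zero, one_mul,
      coeff_zero_eq_constantCoeff_apply]

theorem one_sub_X_mul_rescale :
    (1 - X) * rescale (-1) (1 - X) = expand 2 two_ne_zero (1 - X : ℚ⟦X⟧) := by
  rw [map_sub, map_sub, map_one, map_one, expand_X, rescale_neg_one_X]
  ring

/-- Both sides are square roots of `(1 - X²)⁻¹`; the constant term 1 fixes the sign. -/
theorem oneSubNegPow_half_mul_rescale :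
    oneSubNegPow (1 / 2) * rescale (-1) (oneSubNegPow (1 / 2)) =
      expand 2 two_ne_zero (oneSubNegPow (1 / 2)) := by
  have hs : (1 - X) * oneSubNegPow (1 / 2) ^ 2 = 1 := by
    rw [sq, ← oneSubNegPow_add, ← oneSubNegPow_neg_one, ← oneSubNegPow_add]
    norm_num [oneSubNegPow_zero]
  have hE := congrArg (expand 2 two_ne_zero) hs
  have hN := congrArg (rescale (-1)) hs
  rw [map_mul, map_pow, map_one] at hE hN
  rw [← one_sub_X_mul_rescale] at hE
  set S := oneSubNegPow (1 / 2) with hS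
  have hne : ((1 - X) * rescale (-1) (1 - X) : ℚ⟦X⟧) ≠ 0 := left_ne_zero_of_mul_eq_one hE
  have hsq : (S * rescale (-1) S) ^ 2 = (expand 2 two_ne_zero S) ^ 2 := by
    apply mul_left_cancel₀ hne
    rw [hE]
    linear_combination (rescale (-1) (1 - X) * rescale (-1) S ^ 2) * hs + hN
  rcases sq_eq_sq_iff_eq_or_eq_neg.mp hsq with h | h
  · exact h
  · have := congrArg constantCoeff h
    rw [map_mul, constantCoeff_rescale_eq, map_neg, constantCoeff_expand,
      constantCoeff_oneSubNegPow] at this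
    norm_num at this

theorem oneSubNegPow_neg_half_mul_rescale :
    oneSubNegPow (-1 / 2) * rescale (-1) (oneSubNegPow (-1 / 2)) =
      expand 2 two_ne_zero (oneSubNegPow (-1 / 2)) := by
  have h : oneSubNegPow (-1 / 2) = (1 - X) * oneSubNegPow (1 / 2) := by
    rw [← oneSubNegPow_neg_one, ← oneSubNegPow_add]
    norm_num
  rw [h, map_mul, map_mul, ← one_sub_X_mul_rescale, ← oneSubNegPow_half_mul_rescale]
  ring

/-! ### Coefficients and Pochhammer multiplication formulas. -/

theorem gaussSeries_coeff (a b c : ℚ) (n : ℕ) :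
    coeff n (gaussSeries a b c) = (n.factorial : ℚ)⁻¹ * (ascPochhammer ℚ n).eval a *
      (ascPochhammer ℚ n).eval b * ((ascPochhammer ℚ n).eval c)⁻¹ := by
  rw [gaussSeries, coeff_mk]

theorem gaussSeries_coeff_one (a b : ℚ) (n : ℕ) :
    coeff n (gaussSeries a b 1) = Ring.multichoose a n * Ring.multichoose b n := by
  rw [gaussSeries_coeff, ascPochhammer_eval_one, ascPochhammer_eval_eq, ascPochhammer_eval_eq]
  have : (n.factorial : ℚ) ≠ 0 := by positivity
  field_simp

theorem gaussSeries_self (a c : ℚ) (hc : 0 < c) : gaussSeries a c c = oneSubNegPow a := by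
  ext n
  have := ascPochhammer_pos n c hc
  have : (n.factorial : ℚ) ≠ 0 := by positivity
  rw [gaussSeries_coeff, oneSubNegPow, coeff_mk, multichoose_eq_div]
  field_simp

theorem ascPochhammer_eval_two_mul (x : ℚ) (m : ℕ) :
    (ascPochhammer ℚ (2 * m)).eval (2 * x) =
      4 ^ m * (ascPochhammer ℚ m).eval x * (ascPochhammer ℚ m).eval (x + 1 / 2) := by
  induction m with
  | zero => simp
  | succ m ih =>
    rw [Nat.mul_succ, ascPochhammer_succ_eval, ascPochhammer_succ_eval, ih,
      ascPochhammer_succ_eval, ascPochhammer_succ_eval]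
    push_cast
    ring

theorem ascPochhammer_eval_three_mul (x : ℚ) (m : ℕ) :
    (ascPochhammer ℚ (3 * m)).eval (3 * x) =
      27 ^ m * (ascPochhammer ℚ m).eval x * (ascPochhammer ℚ m).eval (x + 1 / 3) *
        (ascPochhammer ℚ m).eval (x + 2 / 3) := by
  induction m with
  | zero => simp
  | succ m ih =>
    rw [Nat.mul_succ, ascPochhammer_succ_eval, ascPochhammer_succ_eval, ascPochhammer_succ_eval, ih,
      ascPochhammer_succ_eval, ascPochhammer_succ_eval, ascPochhammer_succ_eval]
    push_cast
    ring

theorem ascPochhammer_succ_eval_left (x : ℚ) (n : ℕ) :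
    (ascPochhammer ℚ (n + 1)).eval x = x * (ascPochhammer ℚ n).eval (x + 1) := by
  simp [ascPochhammer_succ_left, Polynomial.eval_comp]

theorem ascPochhammer_eval_two (n : ℕ) : (ascPochhammer ℚ n).eval 2 = (n + 1).factorial := by
  rw [← ascPochhammer_eval_one ℚ, ascPochhammer_succ_eval_left, one_mul, one_add_one_eq_two]

theorem ascPochhammer_eval_half (m : ℕ) :
    4 ^ m * m.factorial * (ascPochhammer ℚ m).eval (1 / 2) = (2 * m).factorial := by
  rw [← ascPochhammer_eval_one ℚ (2 * m), show (1 : ℚ) = 2 * (1 / 2) by norm_num,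
    ascPochhammer_eval_two_mul, ← ascPochhammer_eval_one ℚ m]
  norm_num
  ring

theorem ascPochhammer_eval_three_halves (m : ℕ) :
    4 ^ m * m.factorial * (ascPochhammer ℚ m).eval (3 / 2) = (2 * m + 1).factorial := by
  rw [← ascPochhammer_eval_two (2 * m), show (2 : ℚ) = 2 * 1 by norm_num,
    ascPochhammer_eval_two_mul, ← ascPochhammer_eval_one ℚ m]
  norm_num

/-! ### Denominators of binomial coefficients. -/

theorem factorial_dvd_ascPochhammer_eval (x : ℤ) (n : ℕ) :
    (n.factorial : ℤ) ∣ (ascPochhammer ℤ n).eval x := by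
  refine ⟨Ring.multichoose x n, ?_⟩
  rw [← Polynomial.ascPochhammer_smeval_eq_eval, ← Ring.factorial_nsmul_multichoose_eq_ascPochhammer,
    nsmul_eq_mul]

theorem ascPochhammer_eval_eq_prod {R : Type*} [CommRing R] (x : R) (n : ℕ) :
    (ascPochhammer R n).eval x = ∏ i ∈ Finset.range n, (x + i) := by
  induction n with
  | zero => simp
  | succ n ih => rw [ascPochhammer_succ_eval, ih, Finset.prod_range_succ]

/-- A product of `n` terms of an arithmetic progression with difference `d` is divisible by the
part of `n!` prime to `d`. -/
theorem dvd_prod_progression {d t : ℤ} (a : ℤ) {n : ℕ} (ht : t ∣ n.factorial)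
    (hd : IsCoprime d t) : t ∣ ∏ i ∈ Finset.range n, (a + d * i) := by
  obtain ⟨e, f, hef⟩ := hd
  -- Here `e` inverts `d` modulo `t`, so scaling each factor by `e` turns the progression into
  -- consecutive integers.
  have h1 : (∏ i ∈ Finset.range n, (a + d * i)) * e ^ n ≡
      (ascPochhammer ℤ n).eval (e * a) [ZMOD t] := by
    rw [ascPochhammer_eval_eq_prod, ← Finset.card_range n, ← Finset.prod_const, Finset.card_range,
      ← Finset.prod_mul_distrib]
    refine Int.ModEq.prod fun i _ => ?_
    refine (Int.modEq_iff_dvd.mpr ⟨f * i, ?_⟩)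
    linear_combination (-(i : ℤ)) * hef
  have h2 : t ∣ (∏ i ∈ Finset.range n, (a + d * i)) * e ^ n :=
    h1.dvd_iff.mpr (ht.trans (factorial_dvd_ascPochhammer_eval _ _))
  have hc : IsCoprime t (e ^ n) := IsCoprime.pow_right ⟨f, d, by linear_combination hef⟩
  exact hc.dvd_of_dvd_mul_right h2

/-- The factor `3 ^ n` clears the thirds and leaves a progression divisible by the part of `n!`
prime to 3. By Legendre the 3-adic valuation `v` of `n!` satisfies `2v < n` for `n > 0`, so `3 ^ k`
clears the rest. -/
theorem three_pow_mul_multichoose_mem (a : ℤ) {n k : ℕ} (hk : n ≤ 2 * k + 1) :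
    3 ^ (n + k) * Ring.multichoose (a / 3 : ℚ) n ∈ ratIntegers := by
  have hn : n.factorial ≠ 0 := n.factorial_ne_zero
  obtain ⟨v, t, ht, hvt⟩ := Nat.exists_eq_pow_mul_and_not_dvd hn 3 (by norm_num)
  have : Fact (Nat.Prime 3) := ⟨Nat.prime_three⟩
  have hv : v ≤ k := by
    have hval : padicValNat 3 n.factorial = v := by
      rw [hvt, padicValNat.mul (by positivity) (by rintro rfl; simp at ht),
        padicValNat.prime_pow, padicValNat.eq_zero_of_not_dvd ht, add_zero]
    rcases eq_or_ne n 0 with rfl | h0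
    · simp at hval; omega
    · have := sub_one_mul_padicValNat_factorial_lt_of_ne_zero 3 h0
      omega
  obtain ⟨q, hq⟩ : (t : ℤ) ∣ ∏ i ∈ Finset.range n, (a + 3 * i) := by
    refine dvd_prod_progression a (by rw [hvt]; push_cast; exact dvd_mul_left _ _) ?_
    exact_mod_cast (Nat.isCoprime_iff_coprime.mpr
      ((Nat.Prime.coprime_iff_not_dvd Nat.prime_three).mpr ht))
  obtain ⟨j, rfl⟩ := Nat.exists_eq_add_of_le hv
  refine ⟨3 ^ j * q, ?_⟩
  have hp : 3 ^ n * (ascPochhammer ℚ n).eval (a / 3 : ℚ) = t * q := by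
    rw [ascPochhammer_eval_eq_prod, ← Finset.card_range n, ← Finset.prod_const, Finset.card_range,
      ← Finset.prod_mul_distrib]
    rw [show (t * q : ℚ) = ((t * q : ℤ) : ℚ) by push_cast; ring, ← hq]
    push_cast
    exact Finset.prod_congr rfl fun i _ => by ring
  have ht0 : (t : ℚ) ≠ 0 := by rintro h; apply ht; simp [Nat.cast_eq_zero.mp h]
  rw [multichoose_eq_div, pow_add, hvt]
  push_cast
  rw [eq_intCast]
  push_cast
  field_simp
  linear_combination (-3 ^ j * 3 ^ v : ℚ) * hp

theorem twentySeven_pow_mul_multichoose_mul_mem (a b : ℤ) (n : ℕ) :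
    27 ^ n * (Ring.multichoose (a / 3 : ℚ) n * Ring.multichoose (b / 3 : ℚ) n) ∈ ratIntegers := by
  -- Splitting `n` into its two halves makes the exponents add up to exactly `3n`.
  have ha := three_pow_mul_multichoose_mem a (n := n) (k := n / 2) (by omega)
  have hb := three_pow_mul_multichoose_mem b (n := n) (k := n - n / 2) (by omega)
  have h := mul_mem ha hb
  have he : (27 : ℚ) ^ n = 3 ^ (n + n / 2) * 3 ^ (n + (n - n / 2)) := by
    rw [← pow_add, show (27 : ℚ) = 3 ^ 3 by norm_num, ← pow_mul]
    congr 1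
    omega
  rw [he]
  convert h using 1
  ring

theorem twentySeven_pow_mul_multichoose_mem (a : ℤ) (n : ℕ) :
    27 ^ n * Ring.multichoose (a / 3 : ℚ) n ∈ ratIntegers := by
  have he : (27 : ℚ) ^ n = 3 ^ (n + 2 * n) := by
    rw [show (27 : ℚ) = 3 ^ 3 by norm_num, ← pow_mul]
    congr 1
    omega
  rw [he]
  exact three_pow_mul_multichoose_mem a (by omega)

theorem four_pow_mul_multichoose_half (n : ℕ) :
    4 ^ n * Ring.multichoose (1 / 2 : ℚ) n = n.centralBinom := by
  have h := ascPochhammer_eval_half n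
  have hf : (n.factorial : ℚ) ≠ 0 := by positivity
  rw [Nat.centralBinom, Nat.cast_choose ℚ (by omega), ← h, show 2 * n - n = n by omega,
    multichoose_eq_div]
  field_simp

theorem four_pow_mul_multichoose_half_div (n : ℕ) :
    4 ^ n * (Ring.multichoose (1 / 2 : ℚ) n / (n + 1)) = catalan n := by
  have h := four_pow_mul_multichoose_half n
  rw [← succ_mul_catalan_eq_centralBinom] at h
  push_cast at h
  have : (n + 1 : ℚ) ≠ 0 := by positivity
  field_simp
  linear_combination h

/-! ### Integrality of the rescaled squares. -/

theorem rescale_mem_integralSeries {κ : ℚ} {f : ℚ⟦X⟧}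
    (h : ∀ n, κ ^ n * coeff n f ∈ ratIntegers) : rescale κ f ∈ integralSeries :=
  mem_integralSeries_iff.mpr fun n => by rw [coeff_rescale]; exact h n

theorem rescale_sq_mem_integralSeries {κ : ℚ} {f : ℚ⟦X⟧}
    (h : ∀ n, κ ^ n * coeff n f ∈ ratIntegers) : rescale κ (f ^ 2) ∈ integralSeries := by
  rw [map_pow]
  exact pow_mem (rescale_mem_integralSeries h) 2

theorem rescale_gaussSeries_half_half_two :
    rescale 16 (gaussSeries (1 / 2) (1 / 2) 2 ^ 2) ∈ integralSeries := by
  refine rescale_sq_mem_integralSeries fun n => ?_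
  have h : (16 : ℚ) ^ n * coeff n (gaussSeries (1 / 2) (1 / 2) 2) =
      n.centralBinom * catalan n := by
    rw [← four_pow_mul_multichoose_half, ← four_pow_mul_multichoose_half_div, gaussSeries_coeff,
      ascPochhammer_eval_two, ascPochhammer_eval_eq, Nat.factorial_succ,
      show (16 : ℚ) = 4 * 4 by norm_num, mul_pow]
    have : (n.factorial : ℚ) ≠ 0 := by positivity
    push_cast
    field_simp
  rw [h]
  exact mul_mem (natCast_mem_ratIntegers _) (natCast_mem_ratIntegers _)

theorem rescale_gaussSeries_half_half_one :
    rescale 16 (gaussSeries (1 / 2) (1 / 2) 1 ^ 2) ∈ integralSeries := by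
  refine rescale_sq_mem_integralSeries fun n => ?_
  have h : (16 : ℚ) ^ n * coeff n (gaussSeries (1 / 2) (1 / 2) 1) =
      n.centralBinom * n.centralBinom := by
    rw [← four_pow_mul_multichoose_half, gaussSeries_coeff_one,
      show (16 : ℚ) = 4 * 4 by norm_num, mul_pow]
    ring
  rw [h]
  exact mul_mem (natCast_mem_ratIntegers _) (natCast_mem_ratIntegers _)

theorem rescale_gaussSeries_thirds_one (a b : ℤ) :
    rescale 27 (gaussSeries (a / 3) (b / 3) 1 ^ 2) ∈ integralSeries := by
  refine rescale_sq_mem_integralSeries fun n => ?_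
  rw [gaussSeries_coeff_one]
  exact twentySeven_pow_mul_multichoose_mul_mem a b n

/-- Squaring turns the exponent `-a/6` into `-a/3`, so only the prime 3 remains in the denominators.
-/
theorem rescale_gaussSeries_self (a : ℤ) (c : ℚ) (hc : 0 < c) :
    rescale 27 (gaussSeries (a / 6) c c ^ 2) ∈ integralSeries := by
  rw [gaussSeries_self _ _ hc, sq, ← oneSubNegPow_add]
  refine rescale_mem_integralSeries fun n => ?_
  rw [oneSubNegPow, coeff_mk, show (a / 6 + a / 6 : ℚ) = a / 3 by ring]
  exact twentySeven_pow_mul_multichoose_mem a n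

theorem rescale_gaussSeries_sixth_twoThirds :
    rescale 27 (gaussSeries (1 / 6) (2 / 3) (3 / 2) ^ 2) ∈ integralSeries := by
  refine rescale_sq_mem_integralSeries fun m => ?_
  set u := coeff m (gaussSeries (1 / 6) (2 / 3) (3 / 2)) with hu
  have hd := ascPochhammer_eval_two_mul (1 / 6) m
  have h3 := ascPochhammer_eval_three_halves m
  have hpos : 0 < (ascPochhammer ℚ m).eval (3 / 2 : ℚ) := ascPochhammer_pos m _ (by norm_num)
  have hf : (m.factorial : ℚ) ≠ 0 := by positivity
  have hf2 : ((2 * m + 1).factorial : ℚ) ≠ 0 := by positivity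
  have hf3 : ((2 * m).factorial : ℚ) ≠ 0 := by positivity
  norm_num at hd
  have hu1 : u = (ascPochhammer ℚ (2 * m)).eval (1 / 3) / (2 * m + 1).factorial := by
    rw [hu, gaussSeries_coeff, hd, ← h3]
    field_simp
  have hA : 27 ^ m * Ring.multichoose (1 / 3 : ℚ) (2 * m) = (2 * m + 1) * (27 ^ m * u) := by
    rw [hu1, multichoose_eq_div, Nat.factorial_succ]
    push_cast
    field_simp
  -- Prepending the factor `-2/3` to `(1/3)_(2m)` absorbs the whole of `(2m+1)!`.
  have hB : 3 ^ (2 * m + 1 + m) * Ring.multichoose (-2 / 3 : ℚ) (2 * m + 1) =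
      (-2) * (27 ^ m * u) := by
    rw [hu1, multichoose_eq_div, ascPochhammer_succ_eval_left,
      show 2 * m + 1 + m = 3 * m + 1 by ring, pow_succ, pow_mul]
    norm_num
    ring
  have hA' : (2 * m + 1) * (27 ^ m * u) ∈ ratIntegers := by
    have := three_pow_mul_multichoose_mem 1 (n := 2 * m) (k := m) (by omega)
    rw [show 2 * m + m = 3 * m by ring, pow_mul] at this
    rw [← hA]
    norm_num at this ⊢
    exact this
  have hB' : (-2) * (27 ^ m * u) ∈ ratIntegers := by
    have := three_pow_mul_multichoose_mem (-2) (n := 2 * m + 1) (k := m) (by omega)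
    rw [← hB]
    exact_mod_cast this
  -- `(2m + 1) + m · (-2) = 1`.
  have := add_mem hA' (mul_mem (natCast_mem_ratIntegers m) hB')
  convert this using 1
  ring

theorem rescale_gaussSeries_third_twoThirds :
    rescale 27 (gaussSeries (1 / 3) (2 / 3) (3 / 2) ^ 2) ∈ integralSeries := by
  refine rescale_sq_mem_integralSeries fun m => ?_
  set u := coeff m (gaussSeries (1 / 3) (2 / 3) (3 / 2)) with hu
  have hd := ascPochhammer_eval_three_mul (1 / 3) m
  have h3 := ascPochhammer_eval_three_halves m
  have hpos : 0 < (ascPochhammer ℚ m).eval (3 / 2 : ℚ) := ascPochhammer_pos m _ (by norm_num)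
  have hf : (m.factorial : ℚ) ≠ 0 := by positivity
  have hf2 : ((2 * m + 1).factorial : ℚ) ≠ 0 := by positivity
  have hf3 : ((2 * m).factorial : ℚ) ≠ 0 := by positivity
  norm_num at hd
  have hu1 : 27 ^ m * u = 4 ^ m * ((3 * m).factorial / (m.factorial * (2 * m + 1).factorial)) := by
    rw [hu, gaussSeries_coeff, hd, ← h3]
    field_simp
  have hA : (2 * m + 1) * (27 ^ m * u) = 4 ^ m * (3 * m).choose m := by
    rw [hu1, Nat.cast_choose ℚ (by omega), show 3 * m - m = 2 * m by omega, Nat.factorial_succ]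
    push_cast
    field_simp
  have hB : (3 * m + 1) * (27 ^ m * u) = 4 ^ m * (3 * m + 1).choose m := by
    rw [hu1, Nat.cast_choose ℚ (by omega), show 3 * m + 1 - m = 2 * m + 1 by omega,
      Nat.factorial_succ (3 * m)]
    push_cast
    field_simp
  -- `3(2m + 1) - 2(3m + 1) = 1`.
  have : 27 ^ m * u = ((3 * (4 ^ m * (3 * m).choose m) - 2 * (4 ^ m * (3 * m + 1).choose m) : ℤ)
      : ℚ) := by
    push_cast
    rw [← hA, ← hB]
    ring
  rw [this]
  exact intCast_mem_ratIntegers _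

/-! ### Closed forms of the squares for parameters 1/4, 3/4. -/

theorem coeff_gaussSeries_quarter_half (m : ℕ) :
    coeff m (gaussSeries (1 / 4) (3 / 4) (1 / 2)) = Ring.multichoose (1 / 2 : ℚ) (2 * m) := by
  have hd := ascPochhammer_eval_two_mul (1 / 4) m
  have hpos : 0 < (ascPochhammer ℚ m).eval (1 / 2 : ℚ) := ascPochhammer_pos m _ (by norm_num)
  have hf : (m.factorial : ℚ) ≠ 0 := by positivity
  norm_num at hd hpos
  rw [gaussSeries_coeff, multichoose_eq_div, ← ascPochhammer_eval_half]
  norm_num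
  rw [hd]
  field_simp

theorem coeff_gaussSeries_quarter_three_halves (m : ℕ) :
    coeff m (gaussSeries (1 / 4) (3 / 4) (3 / 2)) =
      -2 * Ring.multichoose (-1 / 2 : ℚ) (2 * m + 1) := by
  have hd := ascPochhammer_eval_two_mul (1 / 4) m
  have hpos : 0 < (ascPochhammer ℚ m).eval (3 / 2 : ℚ) := ascPochhammer_pos m _ (by norm_num)
  have hf : (m.factorial : ℚ) ≠ 0 := by positivity
  norm_num at hd hpos
  rw [gaussSeries_coeff, multichoose_eq_div, ← ascPochhammer_eval_three_halves,
    ascPochhammer_succ_eval_left]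
  norm_num
  rw [hd]
  field_simp

theorem expand_two_injective :
    Function.Injective (expand 2 two_ne_zero : ℚ⟦X⟧ → ℚ⟦X⟧) := fun f g h => by
  ext n
  rw [← coeff_expand_mul 2 two_ne_zero f, h, coeff_expand_mul]

theorem oneSubNegPow_one_add_rescale :
    oneSubNegPow 1 + rescale (-1) (oneSubNegPow 1) = 2 * expand 2 two_ne_zero (oneSubNegPow 1) := by
  ext n
  rw [← map_ofNat (C (R := ℚ)), coeff_C_mul, map_add, coeff_rescale, coeff_expand]
  simp only [oneSubNegPow, coeff_mk, Ring.multichoose_one, mul_one]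
  split_ifs with h
  · rw [(even_iff_two_dvd.mpr h).neg_one_pow]; norm_num
  · rw [(Nat.not_even_iff_odd.mp (mt even_iff_two_dvd.mp h)).neg_one_pow]; norm_num

theorem two_mul_expand_gaussSeries_quarter_half :
    2 * expand 2 two_ne_zero (gaussSeries (1 / 4) (3 / 4) (1 / 2)) =
      oneSubNegPow (1 / 2) + rescale (-1) (oneSubNegPow (1 / 2)) := by
  ext n
  rw [← map_ofNat (C (R := ℚ)), coeff_C_mul, map_add, coeff_rescale]
  rcases Nat.even_or_odd' n with ⟨m, rfl | rfl⟩
  · rw [coeff_expand_mul, coeff_gaussSeries_quarter_half, pow_mul, neg_one_sq, one_pow,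
      oneSubNegPow, coeff_mk]
    ring
  · rw [coeff_expand_of_not_dvd _ _ _ (by omega), pow_succ, pow_mul, neg_one_sq, one_pow]
    ring

theorem X_mul_expand_gaussSeries_quarter_three_halves :
    X * expand 2 two_ne_zero (gaussSeries (1 / 4) (3 / 4) (3 / 2)) =
      rescale (-1) (oneSubNegPow (-1 / 2)) - oneSubNegPow (-1 / 2) := by
  ext n
  rw [map_sub, coeff_rescale]
  cases n with
  | zero => simp
  | succ n =>
    rw [coeff_succ_X_mul]
    rcases Nat.even_or_odd' n with ⟨m, rfl | rfl⟩
    · rw [coeff_expand_mul, coeff_gaussSeries_quarter_three_halves, pow_succ, pow_mul, neg_one_sq,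
        one_pow, oneSubNegPow, coeff_mk]
      ring
    · rw [coeff_expand_of_not_dvd _ _ _ (by omega), pow_succ, pow_succ, pow_mul, neg_one_sq,
        one_pow]
      ring

/-- After `X ↦ X²`, square `2F(X²) = S(X) + S(-X)` with `S = (1 - X)^(-1/2)`; the cross term is `2(1
- X²)^(-1/2)`. -/
theorem two_mul_gaussSeries_quarter_half_sq :
    2 * gaussSeries (1 / 4) (3 / 4) (1 / 2) ^ 2 = oneSubNegPow 1 + oneSubNegPow (1 / 2) := by
  apply expand_two_injective
  have h1 := two_mul_expand_gaussSeries_quarter_half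
  have h2 := oneSubNegPow_half_mul_rescale
  have h3 := oneSubNegPow_one_add_rescale
  have h4 : oneSubNegPow 1 = oneSubNegPow (1 / 2) ^ 2 := by
    rw [sq, ← oneSubNegPow_add]
    norm_num
  rw [map_mul, map_pow, map_add, map_ofNat, ← h2]
  apply mul_left_cancel₀ (show (2 : ℚ⟦X⟧) ≠ 0 by rw [← map_ofNat (C (R := ℚ))]; simp)
  rw [mul_add, ← h3, h4, map_pow]
  linear_combination (2 * expand 2 two_ne_zero (gaussSeries (1 / 4) (3 / 4) (1 / 2)) +
      oneSubNegPow (1 / 2) + rescale (-1) (oneSubNegPow (1 / 2))) * h1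

/-- The same squaring, now with the odd part of `(1 - X)^(1/2)`. -/
theorem X_mul_gaussSeries_quarter_three_halves_sq :
    X * gaussSeries (1 / 4) (3 / 4) (3 / 2) ^ 2 = 2 - 2 * oneSubNegPow (-1 / 2) := by
  apply expand_two_injective
  have h1 := X_mul_expand_gaussSeries_quarter_three_halves
  have h2 := oneSubNegPow_neg_half_mul_rescale
  have h4 : 1 - X = oneSubNegPow (-1 / 2) ^ 2 := by
    rw [sq, ← oneSubNegPow_add, ← oneSubNegPow_neg_one]
    norm_num
  have h5 := congrArg (rescale (-1)) h4
  rw [map_sub, map_one, rescale_neg_one_X, map_pow] at h5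
  rw [map_mul, map_pow, map_sub, map_mul, map_ofNat, ← h2, expand_X]
  linear_combination (X * expand 2 two_ne_zero (gaussSeries (1 / 4) (3 / 4) (3 / 2)) +
      rescale (-1) (oneSubNegPow (-1 / 2)) - oneSubNegPow (-1 / 2)) * h1 - h4 - h5

theorem rescale_gaussSeries_quarter_half :
    rescale 4 (gaussSeries (1 / 4) (3 / 4) (1 / 2) ^ 2) ∈ integralSeries := by
  refine rescale_mem_integralSeries fun n => ?_
  have h := congrArg (coeff n) two_mul_gaussSeries_quarter_half_sq
  rw [← map_ofNat (C (R := ℚ)), coeff_C_mul, map_add, oneSubNegPow, oneSubNegPow, coeff_mk,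
    coeff_mk, Ring.multichoose_one] at h
  have hc := four_pow_mul_multichoose_half n
  cases n with
  | zero =>
    refine ⟨1, ?_⟩
    simp at h ⊢
    linarith
  | succ n =>
    -- The coefficient is half of `4 ^ (n + 1)` plus a central binomial coefficient, both even in
    -- positive degree.
    obtain ⟨d, hd⟩ := Nat.two_dvd_centralBinom_succ n
    rw [hd] at hc
    push_cast at hc
    refine ⟨2 * 4 ^ n + d, ?_⟩
    simp only [eq_intCast]
    push_cast
    linear_combination (-(4 : ℚ) ^ (n + 1) / 2) * h - hc / 2

theorem rescale_gaussSeries_quarter_three_halves :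
    rescale 4 (gaussSeries (1 / 4) (3 / 4) (3 / 2) ^ 2) ∈ integralSeries := by
  refine rescale_mem_integralSeries fun n => ?_
  have h := congrArg (coeff (n + 1)) X_mul_gaussSeries_quarter_three_halves_sq
  rw [coeff_succ_X_mul, ← map_ofNat (C (R := ℚ)), map_sub, coeff_C_mul, coeff_C,
    if_neg n.succ_ne_zero, oneSubNegPow, coeff_mk, multichoose_eq_div,
    ascPochhammer_succ_eval_left, Nat.factorial_succ,
    show (-1 / 2 + 1 : ℚ) = 1 / 2 by norm_num] at h
  have hc := four_pow_mul_multichoose_half_div n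
  rw [multichoose_eq_div] at hc
  have hf : (n.factorial : ℚ) ≠ 0 := by positivity
  rw [h]
  push_cast
  have : (n + 1 : ℚ) ≠ 0 := by positivity
  convert natCast_mem_ratIntegers (catalan n) using 1
  rw [← hc]
  field_simp
  ring

/-! ### The eleven rows. -/

theorem mainTheorem10 (r : ScanRow) (hr : r ∈ scanRows) :
    ∃ A : PowerSeries ℤ,
      PowerSeries.map (Int.castRingHom ℚ) A =
        PowerSeries.rescale r.lam (gaussPullbackSquare r.a r.b r.c r.φ) ∧
      PowerSeries.map (Int.castRingHom ℚ) A =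
        gaussPullbackSquare r.a r.b r.c (PowerSeries.rescale r.lam r.φ) ∧
      ∀ n : ℕ, ((PowerSeries.coeff n A : ℤ) : ℚ) =
        r.lam ^ n * PowerSeries.coeff n (gaussPullbackSquare r.a r.b r.c r.φ) := by
  have hmem := hr
  have hthree : rescale 1 belyiThree = C 27 * PowerSeries.map (Int.castRingHom ℚ)
      (X * invOfUnit ((1 - C (4 * 1) * X) ^ 3) 1) := by
    simpa using rescale_belyiThree 1
  simp only [scanRows, List.mem_cons, List.not_mem_nil, or_false] at hr
  rcases hr with h | h | h | h | h | h | h | h | h | h | h <;> subst h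
  · refine exists_integral_of_rescale_sq_mem hmem 16
      (X * invOfUnit ((1 - C 4 * X) ^ 2) 1) (by simp) ?_
      rescale_gaussSeries_half_half_two
    convert rescale_belyiTwo 4 using 2 <;> norm_num
  · exact exists_integral_of_rescale_sq_mem hmem 27 _ (by simp) hthree
      rescale_gaussSeries_sixth_twoThirds
  · exact exists_integral_of_rescale_sq_mem hmem 27 _ (by simp) hthree
      (by simpa using rescale_gaussSeries_thirds_one 1 1)
  · exact exists_integral_of_rescale_sq_mem hmem 27 _ (by simp) hthree
      (by simpa using rescale_gaussSeries_self 1 (1 / 2) (by norm_num))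
  · refine exists_integral_of_rescale_sq_mem hmem 4
      (X * invOfUnit ((1 - C 1 * X) ^ 2) 1) (by simp) ?_
      rescale_gaussSeries_quarter_half
    convert rescale_belyiTwo 1 using 2 <;> norm_num
  · exact exists_integral_of_rescale_sq_mem hmem 27 _ (by simp) hthree
      rescale_gaussSeries_third_twoThirds
  -- Only `κ = 4` is needed here, so the factor 27 goes into `w`.
  · refine exists_integral_of_rescale_sq_mem hmem 4
      (C 27 * (X * invOfUnit ((1 - C (4 * 4) * X) ^ 3) 1)) (by simp) ?_
      rescale_gaussSeries_quarter_three_halves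
    rw [map_mul, map_C, ← mul_assoc, ← map_mul]
    convert rescale_belyiThree 4 using 2 <;> norm_num
  · exact exists_integral_of_rescale_sq_mem hmem 27 _ (by simp) hthree
      (by simpa using rescale_gaussSeries_thirds_one 1 2)
  · exact exists_integral_of_rescale_sq_mem hmem 27 _ (by simp) hthree
      (by convert rescale_gaussSeries_self 2 (1 / 2) (by norm_num) using 4; norm_num)
  · exact exists_integral_of_rescale_sq_mem hmem 27 _ (by simp) hthree
      (by simpa using rescale_gaussSeries_thirds_one 2 2)
  · refine exists_integral_of_rescale_sq_mem hmem 16 (X * (1 - C 4 * X)) (by simp) ?_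
      rescale_gaussSeries_half_half_one
    convert rescale_belyiPoly 4 using 2 <;> norm_num
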